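/- Let $\mathcal X,\mathcal Y$ be finite alphabets, $W(y\mid x)$ the transition probabilities of a discrete memoryless channel from $\mathcal X$ to $\mathcal Y$, $Q$ a probability distribution on $\mathcal X$, $R$ a real number (the rate) and $L\ge 1$ an integer (the list size). Write $[t]_+=\max(t,0)$, $(Q\times W)(x,y)=Q(x)W(y\mid x)$, $D(\cdot\|\cdot)\in[0,\infty]$ for the Kullback--Leibler divergence, $I_P(X:Y)$ for the mutual information of $(X,Y)\sim P$, and $P_X,P_Y$ for the marginals of a distribution $P$ on $\mathcal X\times\mathcal Y$. The random-coding error exponent is $$E_{\mathrm r}(R,Q)=\min_{P:\,P_X=Q}\; D(P\,\|\,Q\times W)+[I_P(X:Y)-R]_+ ,$$ and, for a metric $g$ that assigns to each distribution on $\mathcal X\times\mathcal Y$ a value in $\mathbb R\cup\{-\infty\}$, the error exponent of randomised list decoding with fixed list size $L$ is $$E_1(R,Q,L)=\min_{P:\,P_X=Q}\;\min_{\tilde P:\,\tilde P_X=Q,\ \tilde P_Y=P_Y}\; D(P\,\|\,Q\times W)+[I_{\tilde P}(X:Y)-R]_+ +L\Big[g(P)-g(\tilde P)-[R-I_{\tilde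 P}(X:Y)]_+\Big]_+ ,$$ where the objective is $+\infty$ whenever $D(P\,\|\,Q\times W)=\infty$. Then, for the matched metric $g(P)=\mathbb E_P[\log W(Y\mid X)]$ (with $\log 0=-\infty$ and $0\cdot(-\infty)=0$), and also for the MMI metric $g(P)=I_P(X:Y)$, all these minima exist and $$E_1(R,Q,L)=E_{\mathrm r}(R,Q).$$ In particular $E_1(R,Q,L)=E_1(R,Q,1)$: increasing the fixed list size $L$ does not improve the exponent. -/

import Mathlib

/-! Joint distributions on finite alphabets `X`, `Y` are elements of `stdSimplex ℝ (X × Y)`. A channel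
is a function `W : X → Y → ℝ` whose rows `W x` are elements of `stdSimplex ℝ Y`, and `W x y` is the
transition probability `W(y | x)`. Logarithms are natural. Exponents are extended real numbers. -/

namespace RandomisedListDecoding

variable {X Y : Type*} [Fintype X] [Fintype Y]

/-- The first marginal `P_X`. -/
def marginalX (P : X × Y → ℝ) (x : X) : ℝ := ∑ y, P (x, y)

/-- The second marginal `P_Y`. -/
def marginalY (P : X × Y → ℝ) (y : Y) : ℝ := ∑ x, P (x, y)

/-- The joint distribution `Q × W`. -/
def jointLaw (Q : X → ℝ) (W : X → Y → ℝ) (z : X × Y) : ℝ := Q z.1 * W z.1 z.2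

open Classical in
/-- The Kullback-Leibler divergence `D(p ‖ q)` of distributions on a finite set: it is `⊤` unless `p` is
absolutely continuous with respect to `q`; summands with `p i = 0` vanish. -/
noncomputable def divergence {ι : Type*} [Fintype ι] (p q : ι → ℝ) : EReal :=
  if ∀ i, q i = 0 → p i = 0 then ((∑ i, p i * Real.log (p i / q i) : ℝ) : EReal) else ⊤

/-- The mutual information `I_P(X : Y)`; summands with `P z = 0` vanish, and in the others
both marginals are positive. -/
noncomputable def mutualInfo (P : X × Y → ℝ) : ℝ :=
  ∑ z : X × Y, P z * Real.log (P z / (marginalX P z.1 * marginalY P z.2))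

open Classical in
/-- The matched metric `g(P) = E_P[log W(Y | X)]`, with `log 0 = -∞` and `0 · (-∞) = 0`. -/
noncomputable def matchedMetric (W : X → Y → ℝ) (P : X × Y → ℝ) : EReal :=
  if ∀ z : X × Y, W z.1 z.2 = 0 → P z = 0 then
    ((∑ z : X × Y, P z * Real.log (W z.1 z.2) : ℝ) : EReal)
  else ⊥

/-- The MMI metric `g(P) = I_P(X : Y)`. -/
noncomputable def mmiMetric (P : X × Y → ℝ) : EReal := (mutualInfo P : EReal)

/-- The joint distributions `P` with `P_X = Q`. -/
def withInput (Y : Type*) [Fintype Y] (Q : X → ℝ) : Set (X × Y → ℝ) :=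
  {P | P ∈ stdSimplex ℝ (X × Y) ∧ marginalX P = Q}

/-- The joint distributions `P'` with `P'_X = Q` and `P'_Y = P_Y`. -/
def withInputOutput (Q : X → ℝ) (P : X × Y → ℝ) : Set (X × Y → ℝ) :=
  {P' | P' ∈ stdSimplex ℝ (X × Y) ∧ marginalX P' = Q ∧ marginalY P' = marginalY P}

/-- `D(P ‖ Q × W) + [I_P(X : Y) - R]₊`. -/
noncomputable def randomCodingObjective (R : ℝ) (Q : X → ℝ) (W : X → Y → ℝ) (P : X × Y → ℝ) :
    EReal :=
  divergence P (jointLaw Q W) + ((max (mutualInfo P - R) 0 : ℝ) : EReal)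

/-- The random-coding exponent `E_r(R, Q)`. -/
noncomputable def randomCodingExponent (R : ℝ) (Q : X → ℝ) (W : X → Y → ℝ) : EReal :=
  ⨅ P ∈ withInput Y Q, randomCodingObjective R Q W P

/-- `D(P ‖ Q × W) + [I_{P'}(X : Y) - R]₊ + L [g(P) - g(P') - [R - I_{P'}(X : Y)]₊]₊`. -/
noncomputable def fixedListObjective (g : (X × Y → ℝ) → EReal) (R : ℝ) (Q : X → ℝ)
    (W : X → Y → ℝ) (L : ℕ) (P P' : X × Y → ℝ) : EReal :=
  divergence P (jointLaw Q W) + ((max (mutualInfo P' - R) 0 : ℝ) : EReal)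
    + ((L : ℝ) : EReal) * max (g P - g P' - ((max (R - mutualInfo P') 0 : ℝ) : EReal)) 0

/-- The inner minimum over `P'` in the fixed-list-size exponent. -/
noncomputable def fixedListInner (g : (X × Y → ℝ) → EReal) (R : ℝ) (Q : X → ℝ)
    (W : X → Y → ℝ) (L : ℕ) (P : X × Y → ℝ) : EReal :=
  ⨅ P' ∈ withInputOutput Q P, fixedListObjective g R Q W L P P'

/-- The fixed-list-size exponent `E_1(R, Q, L)` of the metric `g`. -/
noncomputable def fixedListExponent (g : (X × Y → ℝ) → EReal) (R : ℝ) (Q : X → ℝ)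
    (W : X → Y → ℝ) (L : ℕ) : EReal :=
  ⨅ P ∈ withInput Y Q, fixedListInner g R Q W L P

/-- All minima in the definition of `E_1(R, Q, L)` exist. -/
def FixedListMinimaExist (g : (X × Y → ℝ) → EReal) (R : ℝ) (Q : X → ℝ)
    (W : X → Y → ℝ) (L : ℕ) : Prop :=
  (∀ P ∈ withInput Y Q, ∃ P' ∈ withInputOutput Q P,
    fixedListObjective g R Q W L P P' = fixedListInner g R Q W L P) ∧
  ∃ P ∈ withInput Y Q, fixedListInner g R Q W L P = fixedListExponent g R Q W L

/-- The minimum in the definition of `E_r(R, Q)` exists. -/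
def RandomCodingMinimumExists (R : ℝ) (Q : X → ℝ) (W : X → Y → ℝ) : Prop :=
  ∃ P ∈ withInput Y Q, randomCodingObjective R Q W P = randomCodingExponent R Q W

end RandomisedListDecoding

set_option linter.unusedSectionVars false

namespace RandomisedListDecoding

variable {X Y : Type*} [Fintype X] [Fintype Y]

/-! Taking `P' = P` kills the list term, so `E_1 ≤ E_r`. For the converse, `L ≥ 1` reduces matters
to list size one. Let `i`, `j` be the mutual informations of `P`, `P'`. For MMI, `[j - R]₊ - [R -
j]₊ = j - R` turns the two bracket terms into at least `[i - R]₊`, so `P` itself bounds the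
objective. For the matched metric, `divergence_jointLaw_eq` gives `D = I - H(P_Y) - g`, and `P`,
`P'` share the output entropy. Hence the objective dominates the random-coding objective of `P` if
`i ≤ max R j`, and that of `P'` otherwise. Minima exist by compactness, since finite divergence is a
closed condition on which everything is continuous. -/

/-! ### Marginals, entropies and divergence. -/

lemma le_marginalX {P : X × Y → ℝ} (hP : ∀ z, 0 ≤ P z) (z : X × Y) : P z ≤ marginalX P z.1 :=
  Finset.single_le_sum (f := fun y => P (z.1, y)) (fun _ _ => hP _) (Finset.mem_univ z.2)

lemma le_marginalY {P : X × Y → ℝ} (hP : ∀ z, 0 ≤ P z) (z : X × Y) : P z ≤ marginalY P z.2 :=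
  Finset.single_le_sum (f := fun x => P (x, z.2)) (fun _ _ => hP _) (Finset.mem_univ z.1)

lemma sum_mul_marginalX (P : X × Y → ℝ) (φ : X → ℝ) :
    ∑ z : X × Y, P z * φ z.1 = ∑ x, marginalX P x * φ x := by
  simp only [Fintype.sum_prod_type, marginalX, Finset.sum_mul]

lemma sum_mul_marginalY (P : X × Y → ℝ) (φ : Y → ℝ) :
    ∑ z : X × Y, P z * φ z.2 = ∑ y, marginalY P y * φ y := by
  simp only [Fintype.sum_prod_type_right, marginalY, Finset.sum_mul]

lemma continuous_marginalX : Continuous (marginalX : (X × Y → ℝ) → X → ℝ) := by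
  unfold marginalX; fun_prop

lemma continuous_marginalY : Continuous (marginalY : (X × Y → ℝ) → Y → ℝ) := by
  unfold marginalY; fun_prop

/-- `I(X : Y) = H(X) + H(Y) - H(X, Y)`. -/
lemma mutualInfo_eq_entropies {P : X × Y → ℝ} (hP : ∀ z, 0 ≤ P z) :
    mutualInfo P = ∑ x, Real.negMulLog (marginalX P x) + ∑ y, Real.negMulLog (marginalY P y)
      - ∑ z, Real.negMulLog (P z) := by
  have hX := sum_mul_marginalX P fun x => Real.log (marginalX P x)
  have hY := sum_mul_marginalY P fun y => Real.log (marginalY P y)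
  simp only [Real.negMulLog, neg_mul, Finset.sum_neg_distrib, ← hX, ← hY, mutualInfo]
  rw [← sub_eq_zero, ← Finset.sum_neg_distrib, ← Finset.sum_neg_distrib, ← Finset.sum_neg_distrib,
    ← Finset.sum_add_distrib, ← Finset.sum_sub_distrib, ← Finset.sum_sub_distrib]
  refine Finset.sum_eq_zero fun z _ => ?_
  rcases (hP z).eq_or_lt with h | h
  · simp [← h]
  · have h1 := h.trans_le (le_marginalX hP z)
    have h2 := h.trans_le (le_marginalY hP z)
    rw [Real.log_div h.ne' (mul_pos h1 h2).ne', Real.log_mul h1.ne' h2.ne']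
    ring

/-- The entropy form has no quotients, and `Real.negMulLog` is continuous at `0` too. -/
lemma continuousOn_mutualInfo :
    ContinuousOn (mutualInfo : (X × Y → ℝ) → ℝ) (stdSimplex ℝ (X × Y)) := by
  have hc : Continuous fun P : X × Y → ℝ =>
      ∑ x, Real.negMulLog (marginalX P x) + ∑ y, Real.negMulLog (marginalY P y)
        - ∑ z, Real.negMulLog (P z) := by
    have h1 := continuous_marginalX (X := X) (Y := Y)
    have h2 := continuous_marginalY (X := X) (Y := Y)
    have h3 := Real.continuous_negMulLog
    fun_prop
  exact hc.continuousOn.congr fun P hP => mutualInfo_eq_entropies hP.1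

/-- `D(P ‖ Q × W) = I_P(X : Y) - H(P_Y) - E_P[log W(Y | X)]` when the divergence is finite. -/
lemma divergence_jointLaw_eq {P : X × Y → ℝ} {Q : X → ℝ} {W : X → Y → ℝ}
    (hP : P ∈ withInput Y Q) (hac : ∀ z : X × Y, W z.1 z.2 = 0 → P z = 0) :
    divergence P (jointLaw Q W) = ((mutualInfo P - ∑ y, Real.negMulLog (marginalY P y)
      - ∑ z : X × Y, P z * Real.log (W z.1 z.2) : ℝ) : EReal) := by
  obtain ⟨⟨hP0, -⟩, rfl⟩ := hP
  have hac' : ∀ z, jointLaw (marginalX P) W z = 0 → P z = 0 := by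
    intro z hz
    -- Zeros of `Q` cost nothing: `P` is dominated by its marginal, so only zeros of `W` matter.
    rcases mul_eq_zero.1 hz with h | h
    · exact le_antisymm (h ▸ le_marginalX hP0 z) (hP0 z)
    · exact hac z h
  rw [divergence, if_pos hac', EReal.coe_eq_coe_iff]
  have hY := sum_mul_marginalY P fun y => Real.log (marginalY P y)
  simp only [Real.negMulLog, neg_mul, ← hY, mutualInfo, Finset.sum_neg_distrib]
  rw [← Finset.sum_neg_distrib, ← Finset.sum_sub_distrib, ← Finset.sum_sub_distrib]
  refine Finset.sum_congr rfl fun z _ => ?_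
  rcases (hP0 z).eq_or_lt with h | h
  · simp [← h]
  · have h1 := h.trans_le (le_marginalX hP0 z)
    have h2 := h.trans_le (le_marginalY hP0 z)
    have h3 : W z.1 z.2 ≠ 0 := fun h0 => h.ne' (hac z h0)
    rw [jointLaw, Real.log_div h.ne' (mul_pos h1 h2).ne', Real.log_mul h1.ne' h2.ne',
      Real.log_div h.ne' (mul_ne_zero h1.ne' h3), Real.log_mul h1.ne' h3]
    ring

lemma divergence_jointLaw_eq_top {P : X × Y → ℝ} {W : X → Y → ℝ} (Q : X → ℝ)
    (hac : ¬ ∀ z : X × Y, W z.1 z.2 = 0 → P z = 0) : divergence P (jointLaw Q W) = ⊤ :=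
  if_neg fun h => hac fun z hz => h z (by simp [jointLaw, hz])

/-! ### Compactness and attainment. -/

lemma isClosed_absolutelyContinuous (W : X → Y → ℝ) :
    IsClosed {P : X × Y → ℝ | ∀ z : X × Y, W z.1 z.2 = 0 → P z = 0} := by
  simp only [Set.ofPred_forall]
  exact isClosed_iInter fun z => isClosed_iInter fun _ =>
    isClosed_eq (continuous_apply z) continuous_const

lemma isCompact_withInput (Q : X → ℝ) : IsCompact (withInput Y Q) :=
  (isCompact_stdSimplex ℝ (X × Y)).inter_right (isClosed_eq continuous_marginalX continuous_const)

lemma isCompact_withInputOutput (Q : X → ℝ) (P : X × Y → ℝ) : IsCompact (withInputOutput Q P) :=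
  (isCompact_stdSimplex ℝ (X × Y)).inter_right
    ((isClosed_eq continuous_marginalX continuous_const).inter
      (isClosed_eq continuous_marginalY continuous_const))

lemma self_mem_withInputOutput {Q : X → ℝ} {P : X × Y → ℝ} (hP : P ∈ withInput Y Q) :
    P ∈ withInputOutput Q P := ⟨hP.1, hP.2, rfl⟩

lemma jointLaw_mem_withInput {Q : X → ℝ} (hQ : Q ∈ stdSimplex ℝ X) {W : X → Y → ℝ}
    (hW : ∀ x, W x ∈ stdSimplex ℝ Y) : jointLaw Q W ∈ withInput Y Q := by
  have h : marginalX (jointLaw Q W) = Q := by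
    ext x; simp [marginalX, jointLaw, ← Finset.mul_sum, (hW x).2]
  refine ⟨⟨fun z => mul_nonneg (hQ.1 _) ((hW _).1 _), ?_⟩, h⟩
  rw [Fintype.sum_prod_type, ← hQ.2]
  exact Finset.sum_congr rfl fun x _ => congrFun h x

/-- A function that is real and continuous on a nonempty closed part `S` of a compact set `K`, and `⊤`
on the rest of `K`, attains its infimum on `K`. -/
lemma exists_eq_biInf_of_continuousOn {α : Type*} [TopologicalSpace α] {K S : Set α}
    (hK : IsCompact K) (hS : IsClosed S) (hne : (K ∩ S).Nonempty) {F : α → EReal} {f : α → ℝ}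
    (hf : ContinuousOn f (K ∩ S)) (hFS : ∀ a ∈ K ∩ S, F a = f a) (hFT : ∀ a ∈ K, a ∉ S → F a = ⊤) :
    ∃ a ∈ K, F a = ⨅ b ∈ K, F b := by
  obtain ⟨a, ha, hmin⟩ := (hK.inter_right hS).exists_isMinOn hne hf
  refine ⟨a, ha.1, le_antisymm (le_iInf₂ fun b hb => ?_) (iInf₂_le a ha.1)⟩
  by_cases hbS : b ∈ S
  · rw [hFS a ha, hFS b ⟨hb, hbS⟩, EReal.coe_le_coe_iff]
    exact hmin ⟨hb, hbS⟩
  · rw [hFT b hb hbS]; exact le_top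

lemma randomCodingMinimumExists {Q : X → ℝ} (hQ : Q ∈ stdSimplex ℝ X) {W : X → Y → ℝ}
    (hW : ∀ x, W x ∈ stdSimplex ℝ Y) (R : ℝ) : RandomCodingMinimumExists R Q W := by
  refine exists_eq_biInf_of_continuousOn (isCompact_withInput Q) (isClosed_absolutelyContinuous W)
    (f := fun P => (mutualInfo P - ∑ y, Real.negMulLog (marginalY P y)
      - ∑ z : X × Y, P z * Real.log (W z.1 z.2)) + max (mutualInfo P - R) 0)
    ⟨_, jointLaw_mem_withInput hQ hW, fun z hz => by simp [jointLaw, hz]⟩ ?_ ?_ ?_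
  · have h1 : ContinuousOn (mutualInfo : (X × Y → ℝ) → ℝ)
        (withInput Y Q ∩ {P | ∀ z : X × Y, W z.1 z.2 = 0 → P z = 0}) :=
      continuousOn_mutualInfo.mono fun P hP => hP.1.1
    have h2 := continuous_marginalY (X := X) (Y := Y)
    have h3 := Real.continuous_negMulLog
    fun_prop
  · rintro P ⟨hP, hac⟩
    rw [randomCodingObjective, divergence_jointLaw_eq hP hac, ← EReal.coe_add]
  · intro P hP hac
    rw [randomCodingObjective, divergence_jointLaw_eq_top Q hac, EReal.top_add_coe]

/-! ### Extended-real values of the list objective. -/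

lemma list_term_nonneg (L : ℕ) (t : EReal) : 0 ≤ ((L : ℝ) : EReal) * max t 0 :=
  mul_nonneg (by exact_mod_cast L.cast_nonneg) (le_max_right _ _)

lemma fixedListObjective_eq_top {g : (X × Y → ℝ) → EReal} {R : ℝ} {Q : X → ℝ} {W : X → Y → ℝ}
    {L : ℕ} {P : X × Y → ℝ} (P' : X × Y → ℝ) (h : divergence P (jointLaw Q W) = ⊤) :
    fixedListObjective g R Q W L P P' = ⊤ := by
  rw [fixedListObjective, h, EReal.top_add_coe]
  -- The metrics may be `⊥` here; nonnegativity of the list term alone rules out `⊤ + ⊥`.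
  exact EReal.top_add_of_ne_bot (ne_of_gt (lt_of_lt_of_le EReal.bot_lt_zero (list_term_nonneg _ _)))

lemma fixedListObjective_eq_top_of_bot {g : (X × Y → ℝ) → EReal} {R : ℝ} {Q : X → ℝ}
    {W : X → Y → ℝ} {L : ℕ} (hL : 1 ≤ L) {P P' : X × Y → ℝ} {d a : ℝ}
    (hd : divergence P (jointLaw Q W) = d) (ha : g P = a) (hb : g P' = ⊥) :
    fixedListObjective g R Q W L P P' = ⊤ := by
  rw [fixedListObjective, hd, ha, hb, EReal.coe_sub_bot, EReal.top_sub_coe, max_eq_left le_top,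
    EReal.coe_mul_top_of_pos (by exact_mod_cast hL), ← EReal.coe_add, EReal.coe_add_top]

lemma fixedListObjective_eq_coe {g : (X × Y → ℝ) → EReal} {R : ℝ} {Q : X → ℝ}
    {W : X → Y → ℝ} {L : ℕ} {P P' : X × Y → ℝ} {d a b : ℝ}
    (hd : divergence P (jointLaw Q W) = d) (ha : g P = a) (hb : g P' = b) :
    fixedListObjective g R Q W L P P' = ((d + max (mutualInfo P' - R) 0
      + L * max (a - b - max (R - mutualInfo P') 0) 0 : ℝ) : EReal) := by
  have h : ((max (a - b - max (R - mutualInfo P') 0) 0 : ℝ) : EReal)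
      = max ((a : EReal) - b - ((max (R - mutualInfo P') 0 : ℝ) : EReal)) 0 := by
    rw [EReal.coe_strictMono.monotone.map_max, EReal.coe_sub, EReal.coe_sub, EReal.coe_zero]
  rw [fixedListObjective, hd, ha, hb, EReal.coe_add, EReal.coe_add, EReal.coe_mul, h]

/-- What the matched and the MMI metric have in common: the metric is real and continuous on a closed
set containing every `P` of finite divergence, and `-∞` elsewhere. -/
structure IsRegularMetric (W : X → Y → ℝ) (g : (X × Y → ℝ) → EReal) (f : (X × Y → ℝ) → ℝ)
    (S : Set (X × Y → ℝ)) : Prop where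
  isClosed : IsClosed S
  continuousOn : ContinuousOn f (stdSimplex ℝ (X × Y))
  eq_coe : ∀ P ∈ S, g P = f P
  eq_bot : ∀ P ∉ S, g P = ⊥
  mem : ∀ P : X × Y → ℝ, (∀ z : X × Y, W z.1 z.2 = 0 → P z = 0) → P ∈ S

lemma isRegularMetric_matchedMetric (W : X → Y → ℝ) :
    IsRegularMetric W (matchedMetric W) (fun P => ∑ z : X × Y, P z * Real.log (W z.1 z.2))
      {P | ∀ z : X × Y, W z.1 z.2 = 0 → P z = 0} where
  isClosed := isClosed_absolutelyContinuous W
  continuousOn := by fun_prop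
  eq_coe _ hP := if_pos hP
  eq_bot _ hP := if_neg hP
  mem _ hP := hP

lemma isRegularMetric_mmiMetric (W : X → Y → ℝ) :
    IsRegularMetric W mmiMetric mutualInfo Set.univ where
  isClosed := isClosed_univ
  continuousOn := continuousOn_mutualInfo
  eq_coe _ _ := rfl
  eq_bot P hP := absurd (Set.mem_univ P) hP
  mem P _ := Set.mem_univ P

namespace IsRegularMetric

variable {W : X → Y → ℝ} {g : (X × Y → ℝ) → EReal} {f : (X × Y → ℝ) → ℝ} {S : Set (X × Y → ℝ)}

lemma exists_inner_minimum (hg : IsRegularMetric W g f S) {Q : X → ℝ} {R : ℝ} {L : ℕ} (hL : 1 ≤ L)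
    {P : X × Y → ℝ} (hP : P ∈ withInput Y Q) :
    ∃ P' ∈ withInputOutput Q P,
      fixedListObjective g R Q W L P P' = fixedListInner g R Q W L P := by
  by_cases hac : ∀ z : X × Y, W z.1 z.2 = 0 → P z = 0
  · have hd := divergence_jointLaw_eq hP hac
    have ha := hg.eq_coe P (hg.mem P hac)
    refine exists_eq_biInf_of_continuousOn (isCompact_withInputOutput Q P) hg.isClosed
      ⟨P, self_mem_withInputOutput hP, hg.mem P hac⟩ ?_
      (fun P' hP' => fixedListObjective_eq_coe hd ha (hg.eq_coe P' hP'.2))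
      (fun P' _ hP'S => fixedListObjective_eq_top_of_bot hL hd ha (hg.eq_bot P' hP'S))
    have h1 : ContinuousOn (mutualInfo : (X × Y → ℝ) → ℝ) (withInputOutput Q P ∩ S) :=
      continuousOn_mutualInfo.mono fun P hP => hP.1.1
    have h2 : ContinuousOn f (withInputOutput Q P ∩ S) :=
      hg.continuousOn.mono fun P hP => hP.1.1
    fun_prop
  · have hd := divergence_jointLaw_eq_top Q hac
    -- The objective is constantly `⊤`, so any admissible `P'` is a minimiser.
    refine ⟨P, self_mem_withInputOutput hP, ?_⟩
    rw [fixedListObjective_eq_top P hd]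
    exact (top_le_iff.1 (le_iInf₂ fun P' _ => (fixedListObjective_eq_top P' hd).ge)).symm

lemma objective_self (hg : IsRegularMetric W g f S) {Q : X → ℝ} (R : ℝ) (L : ℕ)
    {P : X × Y → ℝ} (hP : P ∈ withInput Y Q) :
    fixedListObjective g R Q W L P P = randomCodingObjective R Q W P := by
  by_cases hac : ∀ z : X × Y, W z.1 z.2 = 0 → P z = 0
  · have hd := divergence_jointLaw_eq hP hac
    have ha := hg.eq_coe P (hg.mem P hac)
    rw [fixedListObjective_eq_coe hd ha ha, randomCodingObjective, hd, ← EReal.coe_add, sub_self,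
      zero_sub, max_eq_right (neg_nonpos.2 (le_max_right _ _)), mul_zero, add_zero]
  · have hd := divergence_jointLaw_eq_top Q hac
    rw [fixedListObjective_eq_top P hd, randomCodingObjective, hd, EReal.top_add_coe]

lemma inner_le (hg : IsRegularMetric W g f S) {Q : X → ℝ} (R : ℝ) (L : ℕ)
    {P : X × Y → ℝ} (hP : P ∈ withInput Y Q) :
    fixedListInner g R Q W L P ≤ randomCodingObjective R Q W P :=
  (iInf₂_le P (self_mem_withInputOutput hP)).trans (hg.objective_self R L hP).le

lemma exponent_le (hg : IsRegularMetric W g f S) (Q : X → ℝ) (R : ℝ) (L : ℕ) :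
    fixedListExponent g R Q W L ≤ randomCodingExponent R Q W :=
  le_iInf₂ fun P hP => (iInf₂_le P hP).trans (hg.inner_le R L hP)

/-- It suffices to bound the objective from below where it is finite, and for list size one. -/
lemma le_exponent (hg : IsRegularMetric W g f S) {Q : X → ℝ} {R : ℝ} {L : ℕ} (hL : 1 ≤ L)
    (h : ∀ P ∈ withInput Y Q, (∀ z : X × Y, W z.1 z.2 = 0 → P z = 0) →
      ∀ P' ∈ withInputOutput Q P, P' ∈ S → randomCodingExponent R Q W ≤
        ((mutualInfo P - ∑ y, Real.negMulLog (marginalY P y)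
          - ∑ z : X × Y, P z * Real.log (W z.1 z.2) + max (mutualInfo P' - R) 0
          + max (f P - f P' - max (R - mutualInfo P') 0) 0 : ℝ) : EReal)) :
    randomCodingExponent R Q W ≤ fixedListExponent g R Q W L := by
  refine le_iInf₂ fun P hP => le_iInf₂ fun P' hP' => ?_
  by_cases hac : ∀ z : X × Y, W z.1 z.2 = 0 → P z = 0
  · have hd := divergence_jointLaw_eq hP hac
    have ha := hg.eq_coe P (hg.mem P hac)
    by_cases hS : P' ∈ S
    · rw [fixedListObjective_eq_coe hd ha (hg.eq_coe P' hS)]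
      refine (h P hP hac P' hP' hS).trans (EReal.coe_le_coe_iff.2 ?_)
      gcongr
      exact le_mul_of_one_le_left (le_max_right _ _) (by exact_mod_cast hL)
    · rw [fixedListObjective_eq_top_of_bot hL hd ha (hg.eq_bot P' hS)]; exact le_top
  · rw [fixedListObjective_eq_top P' (divergence_jointLaw_eq_top Q hac)]; exact le_top

/-- A minimiser of `E_r` also attains the outer minimum once the exponents agree, so no
semicontinuity of the inner minimum in `P` is needed. -/
lemma minimaExist (hg : IsRegularMetric W g f S) {Q : X → ℝ} {R : ℝ} {L : ℕ} (hL : 1 ≤ L)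
    (hmin : RandomCodingMinimumExists R Q W)
    (heq : fixedListExponent g R Q W L = randomCodingExponent R Q W) :
    FixedListMinimaExist g R Q W L := by
  refine ⟨fun P hP => hg.exists_inner_minimum hL hP, ?_⟩
  obtain ⟨P, hP, hPmin⟩ := hmin
  exact ⟨P, hP, le_antisymm ((hg.inner_le R L hP).trans (hPmin.trans heq.symm).le) (iInf₂_le P hP)⟩

end IsRegularMetric

/-! ### Lower bounds for the two metrics. -/

lemma randomCodingExponent_le_coe {P : X × Y → ℝ} {Q : X → ℝ} {W : X → Y → ℝ} (R : ℝ)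
    (hP : P ∈ withInput Y Q) (hac : ∀ z : X × Y, W z.1 z.2 = 0 → P z = 0) :
    randomCodingExponent R Q W ≤ ((mutualInfo P - ∑ y, Real.negMulLog (marginalY P y)
      - ∑ z : X × Y, P z * Real.log (W z.1 z.2) + max (mutualInfo P - R) 0 : ℝ) : EReal) := by
  refine (iInf₂_le P hP).trans (le_of_eq ?_)
  rw [randomCodingObjective, divergence_jointLaw_eq hP hac, ← EReal.coe_add]

lemma le_fixedListExponent_mmiMetric (Q : X → ℝ) (W : X → Y → ℝ) (R : ℝ) {L : ℕ} (hL : 1 ≤ L) :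
    randomCodingExponent R Q W ≤ fixedListExponent mmiMetric R Q W L := by
  refine (isRegularMetric_mmiMetric W).le_exponent hL fun P hP hac P' _ _ => ?_
  refine (randomCodingExponent_le_coe R hP hac).trans (EReal.coe_le_coe_iff.2 ?_)
  rw [add_assoc _ (max _ _) (max _ _)]
  gcongr
  grind

lemma le_fixedListExponent_matchedMetric (Q : X → ℝ) (W : X → Y → ℝ) (R : ℝ) {L : ℕ}
    (hL : 1 ≤ L) :
    randomCodingExponent R Q W ≤ fixedListExponent (matchedMetric W) R Q W L := by
  refine (isRegularMetric_matchedMetric W).le_exponent hL fun P hP hac P' hP' hac' => ?_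
  have h := le_min (randomCodingExponent_le_coe R hP hac)
    (randomCodingExponent_le_coe R ⟨hP'.1, hP'.2.1⟩ hac')
  -- Equal output marginals make the output entropies in both bounds coincide.
  rw [← EReal.coe_strictMono.monotone.map_min, hP'.2.2] at h
  refine h.trans (EReal.coe_le_coe_iff.2 ?_)
  generalize mutualInfo P = i, mutualInfo P' = j, ∑ y, Real.negMulLog (marginalY P y) = s,
    ∑ z : X × Y, P z * Real.log (W z.1 z.2) = a, ∑ z : X × Y, P' z * Real.log (W z.1 z.2) = b
  -- If `i ≤ max R j`, then `[i - R]₊ ≤ [j - R]₊` and the bound from `P` applies. Otherwise `i - [R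
  -- - j]₊ ≥ j`, and dropping the outer positive part of the list term leaves at least the bound
  -- from `P'`.
  grind

lemma exists_isRegularMetric_and_le {W : X → Y → ℝ} {g : (X × Y → ℝ) → EReal}
    (hg : g = matchedMetric W ∨ g = mmiMetric) (Q : X → ℝ) (R : ℝ) :
    ∃ f S, IsRegularMetric W g f S ∧
      ∀ L : ℕ, 1 ≤ L → randomCodingExponent R Q W ≤ fixedListExponent g R Q W L := by
  rcases hg with rfl | rfl
  · exact ⟨_, _, isRegularMetric_matchedMetric W,
      fun _ hL => le_fixedListExponent_matchedMetric Q W R hL⟩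
  · exact ⟨_, _, isRegularMetric_mmiMetric W,
      fun _ hL => le_fixedListExponent_mmiMetric Q W R hL⟩

end RandomisedListDecoding

theorem corollary1 {X Y : Type*} [Fintype X] [Fintype Y]
    (W : X → Y → ℝ) (hW : ∀ x, W x ∈ stdSimplex ℝ Y)
    (Q : X → ℝ) (hQ : Q ∈ stdSimplex ℝ X)
    (R : ℝ) (L : ℕ) (hL : 1 ≤ L) :
    RandomisedListDecoding.RandomCodingMinimumExists R Q W ∧
    ∀ g : (X × Y → ℝ) → EReal,
      g = RandomisedListDecoding.matchedMetric W ∨ g = RandomisedListDecoding.mmiMetric →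
        RandomisedListDecoding.FixedListMinimaExist g R Q W L ∧
        RandomisedListDecoding.fixedListExponent g R Q W L
          = RandomisedListDecoding.randomCodingExponent R Q W ∧
        RandomisedListDecoding.fixedListExponent g R Q W L
          = RandomisedListDecoding.fixedListExponent g R Q W 1 := by
  have hmin := RandomisedListDecoding.randomCodingMinimumExists hQ hW R
  refine ⟨hmin, fun g hg => ?_⟩
  obtain ⟨f, S, hreg, hle⟩ := RandomisedListDecoding.exists_isRegularMetric_and_le hg Q R
  have heq : ∀ L : ℕ, 1 ≤ L → RandomisedListDecoding.fixedListExponent g R Q W L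
      = RandomisedListDecoding.randomCodingExponent R Q W :=
    fun L hL => le_antisymm (hreg.exponent_le Q R L) (hle L hL)
  exact ⟨hreg.minimaExist hL hmin (heq L hL), heq L hL, (heq L hL).trans (heq 1 le_rfl).symm⟩
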